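/- A graph $X$ consists of a set $V$ of vertices, a set $E$ of edges, source and target maps $s,t\colon E\to V$ and an involution $e\mapsto e^{-1}$ on $E$ with $s(e^{-1})=t(e)$, $t(e^{-1})=s(e)$ and $e^{-1}\neq e$ (so loops and multiple edges are allowed, and each edge is present with both orientations). For $R=\mathbb{Z}$ or $\mathbb{R}$, let $C_1(X,R)$ be the free $R$-module on $E$ modulo the relations $e^{-1}=-e$, let $\partial e=t(e)-s(e)$, and let $Z_1(X,R)=\ker\partial\subseteq C_1(X,R)$. Give $C_1(X,\mathbb{R})$ the inner product for which the edges are orthonormal ($e^{-1}$ counting as $-e$), and let $\pi\colon C_1(X,\mathbb{R})\to Z_1(X,\mathbb{R})$ be the orthogonal projection. Regard $Z_1(X,\mathbb{Z})$ as a subgroup of $Z_1(X,\mathbb{R})$. For a path $\alpha=e_1\cdots e_n$ put $c_\alpha=e_1+\cdots+e_n$. For a basepoint $x_0\in V$ let $$A=\{\pi(c_\alpha) : \alpha \text{ a path in } X \text{ starting at } x_0\},\qquad L=\{\pi(c) : c\in C_1(X,\mathbb{Z})\}.$$ Theorem. Let $X$ be a finite connected graph without bridges (a bridge is an edge whose removal,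 together with its inverse, disconnects $X$), and let $x_0$ be any vertex of $X$. Then $Z_1(X,\mathbb{Z})\subseteq A\subseteq L$, the group $Z_1(X,\mathbb{Z})$ acts by translations on $A$ and on $L$, the quotients $A/Z_1(X,\mathbb{Z})$ and $L/Z_1(X,\mathbb{Z})$ are finite, and $$|A/Z_1(X,\mathbb{Z})|=|V|,\qquad |L/Z_1(X,\mathbb{Z})|=|T|,$$ where $T$ is the set of spanning trees of $X$. In particular the packing fraction of $X$ is $$\frac{|A/Z_1(X,\mathbb{Z})|}{|L/Z_1(X,\mathbb{Z})|}=\frac{|V|}{|T|}.$$ -/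

import Mathlib

universe u v w z

/-- A graph with vertex set `V` and edge set `E`, with every edge present in both directions:
`inv e` is the inverse of the edge `e`. Loops and multiple edges are allowed. -/
structure SymmGraph (V : Type u) (E : Type v) where
  src : E → V
  tgt : E → V
  inv : E → E
  src_inv : ∀ e, src (inv e) = tgt e
  tgt_inv : ∀ e, tgt (inv e) = src e
  inv_inv : ∀ e, inv (inv e) = e
  inv_ne : ∀ e, inv e ≠ e

namespace SymmGraph

variable {V : Type u} {E : Type v} (X : SymmGraph V E)

/-! ### Paths, connectedness, bridges, spanning trees -/

/-- Paths from `x` to `y`; `cons e p` is the path that first runs along `e` and then along `p`. -/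
inductive Path : V → V → Type (max u v)
  | nil (x : V) : Path x x
  | cons (e : E) {y : V} (p : Path (X.tgt e) y) : Path (X.src e) y

/-- The word of edges of a path. -/
def Path.edges {X : SymmGraph V E} : {x y : V} → X.Path x y → List E
  | _, _, .nil _ => []
  | _, _, .cons e p => e :: p.edges

/-- A path is reduced if it never traverses an edge and then immediately its inverse. -/
def Path.IsReduced {X : SymmGraph V E} {x y : V} (p : X.Path x y) : Prop :=
  p.edges.IsChain (fun e f => f ≠ X.inv e)

def Connected : Prop := Nonempty V ∧ ∀ x y : V, Nonempty (X.Path x y)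

/-- The subgraph with all the vertices, and with a given inversion-closed set of edges. -/
def edgeSubgraph (S : Set E) (hS : ∀ e ∈ S, X.inv e ∈ S) : SymmGraph V S where
  src e := X.src e
  tgt e := X.tgt e
  inv e := ⟨X.inv e, hS e e.2⟩
  src_inv e := X.src_inv e
  tgt_inv e := X.tgt_inv e
  inv_inv e := Subtype.ext (X.inv_inv e)
  inv_ne e h := X.inv_ne e (congrArg Subtype.val h)

/-- The graph with the edge `e` (and so also its inverse) removed. -/
def deleteEdge (e : E) : SymmGraph V ({f | f ≠ e ∧ f ≠ X.inv e} : Set E) :=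
  X.edgeSubgraph {f | f ≠ e ∧ f ≠ X.inv e} fun f hf =>
    ⟨fun h => hf.2 (by rw [← h, X.inv_inv]), fun h => hf.1 (by
      rw [← X.inv_inv f, h, X.inv_inv])⟩

/-- A bridge is an edge whose removal disconnects two vertices that were connected in `X`. -/
def IsBridge (e : E) : Prop :=
  ∃ x y : V, Nonempty (X.Path x y) ∧ IsEmpty ((X.deleteEdge e).Path x y)

/-- A tree is a connected graph without circuits: every reduced loop is trivial. -/
def IsTree : Prop :=
  X.Connected ∧ ∀ (x : V) (p : X.Path x x), p.IsReduced → p.edges = []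

/-- The spanning trees of `X`; a spanning tree is given by its (inversion-closed) set of edges. -/
def spanningTrees : Set (Set E) :=
  {S | ∃ hS : ∀ e ∈ S, X.inv e ∈ S, (X.edgeSubgraph S hS).IsTree}

/-! ### Chains and cycles -/

/-- The group of 1-chains with coefficients in `R`: the free `R`-module on the edges, modulo the
relations `e⁻¹ = -e`. -/
def Chains₁ (R : Type w) [CommRing R] : Type (max v w) :=
  (E →₀ R) ⧸ Submodule.span R
    (Set.range fun e => Finsupp.single (X.inv e) (1 : R) + Finsupp.single e (1 : R))

section

variable (R : Type w) [CommRing R]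

noncomputable instance : AddCommGroup (X.Chains₁ R) :=
  inferInstanceAs (AddCommGroup ((E →₀ R) ⧸ Submodule.span R
    (Set.range fun e => Finsupp.single (X.inv e) (1 : R) + Finsupp.single e (1 : R))))

noncomputable instance : Module R (X.Chains₁ R) :=
  inferInstanceAs (Module R ((E →₀ R) ⧸ Submodule.span R
    (Set.range fun e => Finsupp.single (X.inv e) (1 : R) + Finsupp.single e (1 : R))))

instance [Finite E] : Module.Finite R (X.Chains₁ R) :=
  inferInstanceAs (Module.Finite R ((E →₀ R) ⧸ Submodule.span R
    (Set.range fun e => Finsupp.single (X.inv e) (1 : R) + Finsupp.single e (1 : R))))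

/-- The quotient map from the free module on the edges. -/
noncomputable def chainMk : (E →₀ R) →ₗ[R] X.Chains₁ R :=
  Submodule.mkQ (Submodule.span R
    (Set.range fun e => Finsupp.single (X.inv e) (1 : R) + Finsupp.single e (1 : R)))

theorem chainMk_surjective : Function.Surjective (X.chainMk R) :=
  Submodule.mkQ_surjective _

/-- An edge, seen as a 1-chain. -/
noncomputable def edge (e : E) : X.Chains₁ R := X.chainMk R (Finsupp.single e 1)

theorem edge_inv (e : E) : X.edge R (X.inv e) = - X.edge R e := by
  rw [eq_neg_iff_add_eq_zero, edge, edge, ← map_add]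
  exact (Submodule.Quotient.mk_eq_zero _).2 (Submodule.subset_span ⟨e, rfl⟩)

variable {M : Type z} [AddCommGroup M] [Module R M]

/-- The linear map on 1-chains with prescribed values on edges. -/
noncomputable def lift (f : E → M) (hf : ∀ e, f (X.inv e) = - f e) : X.Chains₁ R →ₗ[R] M :=
  Submodule.liftQ _ (Finsupp.linearCombination R f) (by
    rw [Submodule.span_le]
    rintro _ ⟨e, rfl⟩
    simp [hf])

theorem lift_chainMk (f : E → M) (hf : ∀ e, f (X.inv e) = - f e) (a : E →₀ R) :
    X.lift R f hf (X.chainMk R a) = Finsupp.linearCombination R f a :=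
  Submodule.liftQ_apply _ _ _

theorem lift_edge (f : E → M) (hf : ∀ e, f (X.inv e) = - f e) (e : E) :
    X.lift R f hf (X.edge R e) = f e := by
  simp [edge, lift_chainMk]

/-- The boundary map from 1-chains to 0-chains, `∂ e = t(e) - s(e)`. -/
noncomputable def boundary : X.Chains₁ R →ₗ[R] (V →₀ R) :=
  X.lift R (fun e => Finsupp.single (X.tgt e) 1 - Finsupp.single (X.src e) 1)
    (fun e => by simp [X.src_inv, X.tgt_inv])

/-- The module of 1-cycles with coefficients in `R`. -/
noncomputable def cycles : Submodule R (X.Chains₁ R) := LinearMap.ker (X.boundary R)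

open scoped Classical in
/-- The coefficients of a 1-chain: `coeff c e` is the coefficient of `e` in `c`, so that
`coeff c e⁻¹ = - coeff c e`. -/
noncomputable def coeff : X.Chains₁ R →ₗ[R] (E → R) :=
  X.lift R (fun e => Pi.single e 1 - Pi.single (X.inv e) 1)
    (fun e => by simp [X.inv_inv])

end

/-- The 1-chain of a path, `c_γ = e₁ + ⋯ + eₙ`. -/
noncomputable def Path.chain {X : SymmGraph V E} {x y : V} (p : X.Path x y) : X.Chains₁ ℤ :=
  (p.edges.map (X.edge ℤ)).sum

/-- The natural map from integral 1-chains to real 1-chains. -/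
noncomputable def toReal : X.Chains₁ ℤ →+ X.Chains₁ ℝ :=
  (X.lift ℤ (X.edge ℝ) (X.edge_inv ℝ)).toAddMonoidHom

/-! ### The inner product for which the edges are orthonormal -/

theorem sum_coeff_smul [Fintype E] (c : X.Chains₁ ℝ) :
    ∑ e, X.coeff ℝ c e • X.edge ℝ e = (2 : ℝ) • c := by
  classical
  obtain ⟨a, rfl⟩ := X.chainMk_surjective ℝ c
  induction a using Finsupp.induction_linear with
  | zero => simp
  | add a b ha hb =>
    simp only [map_add, Pi.add_apply, add_smul, Finset.sum_add_distrib, ha, hb, smul_add]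
  | single e r =>
    have h : X.chainMk ℝ (Finsupp.single e r) = r • X.edge ℝ e := by
      rw [edge, ← map_smul]; simp
    rw [h, map_smul, coeff, lift_edge]
    simp only [Pi.smul_apply, Pi.sub_apply, Pi.single_apply, smul_eq_mul, mul_sub, sub_smul,
      Finset.sum_sub_distrib, mul_ite, mul_one, mul_zero, ite_smul, zero_smul,
      Finset.sum_ite_eq', Finset.mem_univ, if_true, edge_inv]
    module

/-- The inner product on real 1-chains is `⟪c, d⟫ = ∑ c_e d_e`, summed over unoriented edges, that
is, half of the sum over all edges. -/
@[reducible]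
noncomputable def innerCore [Fintype E] : InnerProductSpace.Core ℝ (X.Chains₁ ℝ) where
  inner c d := (1 / 2) * ∑ e, X.coeff ℝ c e * X.coeff ℝ d e
  conj_inner_symm c d := by simp [mul_comm]
  re_inner_nonneg c := by
    have : 0 ≤ ∑ e, X.coeff ℝ c e * X.coeff ℝ c e :=
      Finset.sum_nonneg fun e _ => mul_self_nonneg _
    simpa using this
  add_left c d f := by simp [add_mul, Finset.sum_add_distrib, mul_add]
  smul_left c d r := by
    simp only [map_smul, Pi.smul_apply, smul_eq_mul, conj_trivial, mul_assoc, ← Finset.mul_sum]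
    ring
  definite c h := by
    have h0 : ∑ e, X.coeff ℝ c e * X.coeff ℝ c e = 0 := by simpa using h
    have h1 := (Finset.sum_eq_zero_iff_of_nonneg fun e _ => mul_self_nonneg (X.coeff ℝ c e)).1 h0
    have h2 : (2 : ℝ) • c = 0 := by
      rw [← X.sum_coeff_smul c]
      exact Finset.sum_eq_zero fun e he => by rw [mul_self_eq_zero.1 (h1 e he), zero_smul]
    simpa using h2

noncomputable instance [Fintype E] : NormedAddCommGroup (X.Chains₁ ℝ) :=
  X.innerCore.toNormedAddCommGroup

noncomputable instance [Fintype E] : InnerProductSpace ℝ (X.Chains₁ ℝ) :=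
  InnerProductSpace.ofCore X.innerCore.toCore

theorem inner_def [Fintype E] (c d : X.Chains₁ ℝ) :
    inner ℝ c d = (1 / 2) * ∑ e, X.coeff ℝ c e * X.coeff ℝ d e := rfl

/-- Choosing one edge out of each pair `e, e⁻¹` gives an orthonormal family. -/
theorem inner_edge [Fintype E] [DecidableEq E] (e f : E) :
    inner ℝ (X.edge ℝ e) (X.edge ℝ f) = if f = e then 1 else if f = X.inv e then -1 else 0 := by
  have hi : ∀ a b, X.inv a = X.inv b ↔ a = b := fun a b =>
    ⟨fun h => by rw [← X.inv_inv a, h, X.inv_inv], fun h => by rw [h]⟩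
  have hj : ∀ a b, X.inv a = b ↔ a = X.inv b := fun a b =>
    ⟨fun h => by rw [← h, X.inv_inv], fun h => by rw [h, X.inv_inv]⟩
  have h0 := X.inv_ne e
  rw [inner_def, coeff, lift_edge, lift_edge]
  simp only [Pi.sub_apply, Pi.single_apply, sub_mul, Finset.sum_sub_distrib, ite_mul, one_mul,
    zero_mul, Finset.sum_ite_eq', Finset.mem_univ, if_true, hi]
  have h1 : (e = X.inv f) ↔ f = X.inv e := by rw [← hj, eq_comm]
  have h2 : (X.inv e = f) ↔ f = X.inv e := eq_comm
  have h3 : (e = f) ↔ f = e := eq_comm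
  simp only [h1, h2, h3]
  by_cases ha : f = e
  · subst ha; simp [h0.symm]; norm_num
  · by_cases hb : f = X.inv e <;> (simp [ha, hb, h0]; try norm_num)

/-! ### Atoms, the lattice `L`, and the packing fraction -/

section

variable [Fintype E]

/-- The orthogonal projection from real 1-chains onto real 1-cycles. -/
noncomputable def proj : X.Chains₁ ℝ →L[ℝ] X.cycles ℝ := (X.cycles ℝ).orthogonalProjectionOnto

/-- The group of integral 1-cycles, as a subgroup of the space of real 1-cycles. -/
noncomputable def integralCycles : AddSubgroup (X.cycles ℝ) :=
  ((X.cycles ℤ).toAddSubgroup.map X.toReal).comap (X.cycles ℝ).subtype.toAddMonoidHom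

/-- The lattice `L`: the projection of the integral 1-chains to the space of 1-cycles. -/
noncomputable def latticeL : AddSubgroup (X.cycles ℝ) :=
  ((X.proj : X.Chains₁ ℝ →ₗ[ℝ] X.cycles ℝ).toAddMonoidHom.comp X.toReal).range

/-- The set `A` of atoms, as points of the space of 1-cycles: the projections of the 1-chains of
the paths that start at the basepoint. -/
def atoms (x₀ : V) : Set (X.cycles ℝ) :=
  {a | ∃ (x : V) (α : X.Path x₀ x), a = X.proj (X.toReal α.chain)}

/-- Two atoms are equivalent if a translation by an integral 1-cycle takes one to the other. -/
def atomSetoid (x₀ : V) : Setoid (X.atoms x₀) where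
  r a b := ∃ c ∈ X.integralCycles, c + (a : X.cycles ℝ) = b
  iseqv :=
    { refl := fun a => ⟨0, zero_mem _, zero_add _⟩
      symm := fun ⟨c, hc, h⟩ => ⟨-c, neg_mem hc, by rw [← h, neg_add_cancel_left]⟩
      trans := fun ⟨c, hc, h⟩ ⟨d, hd, k⟩ =>
        ⟨d + c, add_mem hd hc, by rw [← k, ← h, add_assoc]⟩ }

/-- `A / Z₁(X, ℤ)`. -/
abbrev AtomQuotient (x₀ : V) : Type v := Quotient (X.atomSetoid x₀)

/-- `L / Z₁(X, ℤ)`. -/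
abbrev LatticeQuotient : Type v := X.latticeL ⧸ X.integralCycles.addSubgroupOf X.latticeL

/-- The packing fraction. -/
noncomputable def packingFraction (x₀ : V) : ℚ :=
  (Nat.card (X.AtomQuotient x₀) : ℚ) / (Nat.card X.LatticeQuotient : ℚ)

end

end SymmGraph

/-! An integral chain projects to zero exactly when it is an integral cut `c_e = g (t e) - g (s e)`
(`Connected.proj_toReal_eq_zero_iff`). So `π(c)` is an integral cycle iff `c` is a cycle plus a cut,
i.e. iff `∂c` is the boundary of a cut. Away from `x₀`, the boundary of the cut of `g` with `g x₀ =
0` is the reduced Laplacian applied to `g`. Hence `L / Z₁(X, ℤ)` is the cokernel of that matrix, and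
its order is the determinant, which is nonzero by connectedness. Expanded along its rows, the
determinant is a sum over choices of an edge out of each vertex other than `x₀`; a choice
contributes 1 if it leads every vertex to `x₀` and 0 otherwise, and the former choices are the
spanning trees oriented towards `x₀`.

For atoms, two paths from `x₀` with the same end differ by an integral cycle, so the end determines
the class. Conversely, equivalent atoms with ends `x` and `y` give an integral cut with boundary `x
- y`. Its net flow into a superlevel set of `g` is at most 1, whereas without bridges a suitable
superlevel set is entered by at least two edges unless `x = y` (`eq_of_boundary_eq`). -/

namespace SymmGraph

variable {V : Type u} {E : Type v} (X : SymmGraph V E)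

/-! ### Walks as lists of edges -/

/-- `X.IsWalk x l y` says that the word `l` of edges is a path from `x` to `y`. -/
def IsWalk : V → List E → V → Prop
  | x, [], y => x = y
  | x, e :: l, y => X.src e = x ∧ IsWalk (X.tgt e) l y

/-- The words that never traverse an edge and then immediately its inverse. -/
abbrev IsReducedWord (l : List E) : Prop := l.IsChain (fun e f => f ≠ X.inv e)

variable {X}

theorem Path.isWalk {x y : V} (p : X.Path x y) : X.IsWalk x p.edges y := by
  induction p with
  | nil x => exact rfl
  | cons e p ih => exact ⟨rfl, ih⟩

theorem IsWalk.exists_path {x y : V} {l : List E} (h : X.IsWalk x l y) :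
    ∃ p : X.Path x y, p.edges = l := by
  induction l generalizing x with
  | nil => obtain rfl : x = y := h; exact ⟨.nil x, rfl⟩
  | cons e l ih =>
    obtain ⟨rfl, h⟩ := h
    obtain ⟨p, hp⟩ := ih h
    exact ⟨.cons e p, congrArg (e :: ·) hp⟩

theorem nonempty_path_iff {x y : V} : Nonempty (X.Path x y) ↔ ∃ l, X.IsWalk x l y :=
  ⟨fun ⟨p⟩ => ⟨_, p.isWalk⟩, fun ⟨_, h⟩ => ⟨h.exists_path.choose⟩⟩

theorem IsWalk.append {x y z : V} {l m : List E} (h : X.IsWalk x l y) (k : X.IsWalk y m z) :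
    X.IsWalk x (l ++ m) z := by
  induction l generalizing x with
  | nil => obtain rfl : x = y := h; exact k
  | cons e l ih => exact ⟨h.1, ih h.2⟩

theorem isWalk_singleton (e : E) : X.IsWalk (X.src e) [e] (X.tgt e) := ⟨rfl, rfl⟩

theorem IsWalk.reverse {x y : V} {l : List E} (h : X.IsWalk x l y) :
    X.IsWalk y (l.map X.inv).reverse x := by
  induction l generalizing x with
  | nil => exact Eq.symm h
  | cons e l ih =>
    obtain ⟨rfl, h⟩ := h
    rw [List.map_cons, List.reverse_cons]
    exact (ih h).append ⟨X.src_inv e, X.tgt_inv e⟩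

/-- Put `e` in front of the reduced tail, cancelling if the tail starts with `e⁻¹`. The inclusion `m
⊆ l` keeps the reduced word in a given subgraph. -/
theorem IsWalk.exists_reduced {x y : V} {l : List E} (h : X.IsWalk x l y) :
    ∃ m, X.IsWalk x m y ∧ X.IsReducedWord m ∧ m ⊆ l := by
  induction l generalizing x with
  | nil => exact ⟨[], h, List.isChain_nil, List.Subset.refl _⟩
  | cons e l ih =>
    obtain ⟨rfl, h⟩ := h
    obtain ⟨m, hm, hr, hs⟩ := ih h
    match m, hm, hr, hs with
    | [], hm, _, _ => exact ⟨[e], ⟨rfl, hm⟩, List.isChain_singleton _, by simp⟩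
    | f :: m, hm, hr, hs =>
      by_cases hf : f = X.inv e
      · subst hf
        refine ⟨m, ?_, hr.tail, ?_⟩
        · simpa only [X.tgt_inv] using hm.2
        · exact fun a ha => List.mem_cons_of_mem _ (hs (List.mem_cons_of_mem _ ha))
      · exact ⟨e :: f :: m, ⟨rfl, hm⟩, List.isChain_cons_cons.2 ⟨hf, hr⟩,
          List.cons_subset_cons _ hs⟩

section Subgraph

variable {S : Set E} {hS : ∀ e ∈ S, X.inv e ∈ S}

theorem isWalk_edgeSubgraph_iff {x y : V} {l : List S} :
    (X.edgeSubgraph S hS).IsWalk x l y ↔ X.IsWalk x (l.map Subtype.val) y := by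
  induction l generalizing x with
  | nil => exact Iff.rfl
  | cons e l ih => exact and_congr Iff.rfl ih

theorem isReducedWord_edgeSubgraph_iff {l : List S} :
    (X.edgeSubgraph S hS).IsReducedWord l ↔ X.IsReducedWord (l.map Subtype.val) := by
  rw [IsReducedWord, IsReducedWord, List.isChain_map]
  simp only [ne_eq, Subtype.ext_iff]
  exact Iff.rfl

theorem exists_isWalk_edgeSubgraph_iff {x y : V} :
    (∃ l, (X.edgeSubgraph S hS).IsWalk x l y) ↔ ∃ l, X.IsWalk x l y ∧ ∀ e ∈ l, e ∈ S := by
  constructor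
  · rintro ⟨l, h⟩
    refine ⟨_, isWalk_edgeSubgraph_iff.1 h, ?_⟩
    simpa using fun e he _ => he
  · rintro ⟨l, h, hl⟩
    lift l to List S using hl
    exact ⟨l, isWalk_edgeSubgraph_iff.2 h⟩

theorem isTree_edgeSubgraph_iff [Nonempty V] :
    (X.edgeSubgraph S hS).IsTree ↔
      (∀ x y, ∃ l, X.IsWalk x l y ∧ ∀ e ∈ l, e ∈ S) ∧
        ∀ x l, X.IsWalk x l x → (∀ e ∈ l, e ∈ S) → X.IsReducedWord l → l = [] := by
  refine and_congr ?_ ?_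
  · simp only [Connected, nonempty_path_iff, exists_isWalk_edgeSubgraph_iff]
    exact and_iff_right ‹_›
  · refine forall_congr' fun x => ⟨fun h l hl hs hr => ?_, fun h p hr => ?_⟩
    · lift l to List S using hs
      obtain ⟨p, rfl⟩ := (isWalk_edgeSubgraph_iff (hS := hS).2 hl).exists_path
      rw [h p (isReducedWord_edgeSubgraph_iff.2 hr), List.map_nil]
    · refine List.map_eq_nil_iff.1 (h _ (isWalk_edgeSubgraph_iff.1 p.isWalk) ?_
        (isReducedWord_edgeSubgraph_iff.1 hr))
      simpa using fun e he _ => he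

end Subgraph

/-! ### Spanning trees as functions with a single sink -/

variable (X)

/-- The choice, for each vertex other than `x₀`, of an edge leaving it. -/
abbrev OutChoice (x₀ : V) : Type (max u v) := ∀ i : {x : V // x ≠ x₀}, {e : E // X.src e = i}

namespace OutChoice

variable {X} {x₀ : V} (f : X.OutChoice x₀)

open scoped Classical in
/-- The end of the chosen edge, with `x₀` as a fixed point. -/
noncomputable def next (x : V) : V := if h : x = x₀ then x₀ else X.tgt (f ⟨x, h⟩)

@[simp] theorem next_base : f.next x₀ = x₀ := by simp [next]

theorem next_coe (i : {x : V // x ≠ x₀}) : f.next i = X.tgt (f i) := by simp [next, i.2]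

/-- From every vertex, the chosen edges lead to `x₀`. -/
def Flows : Prop := ∀ x, ∃ n, f.next^[n] x = x₀

/-- The chosen edges and their inverses. -/
def support : Set E := {e | ∃ i, e = f i ∨ e = X.inv (f i)}

theorem inv_mem_support {e : E} (he : e ∈ f.support) : X.inv e ∈ f.support := by
  obtain ⟨i, rfl | rfl⟩ := he
  · exact ⟨i, Or.inr rfl⟩
  · exact ⟨i, Or.inl (X.inv_inv _)⟩

variable {f}

/-- The number of steps that lead from `x` to `x₀`. -/
theorem Flows.exists_height (hf : f.Flows) :
    ∃ h : V → ℕ, h x₀ = 0 ∧ ∀ i : {x : V // x ≠ x₀}, h i = h (f.next i) + 1 := by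
  classical
  refine ⟨fun x => Nat.find (hf x), (Nat.find_eq_zero _).2 rfl, fun i => ?_⟩
  rw [Nat.find_eq_iff]
  constructor
  · rw [Function.iterate_succ_apply]
    exact Nat.find_spec (hf (f.next i))
  · rintro (_ | n) hn
    · exact i.2
    · rw [Function.iterate_succ_apply]
      exact Nat.find_min (hf (f.next i)) (Nat.succ_lt_succ_iff.1 hn)

theorem flows_of_lt (h : V → ℕ) (hh : ∀ i : {x : V // x ≠ x₀}, h (X.tgt (f i)) < h i) :
    f.Flows := by
  intro x
  induction hn : h x using Nat.strong_induction_on generalizing x with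
  | _ n ih =>
    by_cases hx : x = x₀
    · exact ⟨0, hx⟩
    · obtain ⟨k, hk⟩ := ih _ (hn ▸ hh ⟨x, hx⟩) _ rfl
      refine ⟨k + 1, ?_⟩
      rw [Function.iterate_succ_apply]
      convert hk using 2
      exact f.next_coe ⟨x, hx⟩

theorem Flows.exists_isWalk (hf : f.Flows) (x : V) :
    ∃ l, X.IsWalk x l x₀ ∧ ∀ e ∈ l, e ∈ f.support := by
  obtain ⟨n, hn⟩ := hf x
  induction n generalizing x with
  | zero => exact ⟨[], hn, by simp⟩
  | succ n ih =>
    by_cases hx : x = x₀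
    · exact ⟨[], hx, by simp⟩
    · rw [Function.iterate_succ_apply, f.next_coe ⟨x, hx⟩] at hn
      obtain ⟨l, hl, hs⟩ := ih _ hn
      refine ⟨f ⟨x, hx⟩ :: l, ⟨(f ⟨x, hx⟩).2, hl⟩, ?_⟩
      rintro e (_ | ⟨_, he⟩)
      · exact ⟨⟨x, hx⟩, Or.inl rfl⟩
      · exact hs e he

/-- Truncated subtraction is the right form: `x₀` has height 0 and is fixed by `next`. -/
theorem height_iterate {h : V → ℕ} (hh : ∀ i : {x : V // x ≠ x₀}, h i = h (f.next i) + 1)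
    (h0 : h x₀ = 0) (n : ℕ) (x : V) : h (f.next^[n] x) = h x - n := by
  induction n generalizing x with
  | zero => rfl
  | succ n ih =>
    rw [Function.iterate_succ_apply, ih]
    by_cases hx : x = x₀
    · subst hx; simp [h0]
    · have := hh ⟨x, hx⟩
      simp only at this
      omega

end OutChoice
end SymmGraph

namespace SymmGraph

variable {V : Type u} {E : Type v} {X : SymmGraph V E}

namespace OutChoice

variable {x₀ : V} {f : X.OutChoice x₀}

/-- Of two points on one orbit, the later is an iterate of the earlier, and heights drop strictly
until `x₀`. -/
theorem ancestor_unique {h : V → ℕ} (h0 : h x₀ = 0)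
    (hh : ∀ i : {x : V // x ≠ x₀}, h i = h (f.next i) + 1) {i j : {x : V // x ≠ x₀}} {y : V}
    {a b : ℕ} (hi : f.next^[a] y = i) (hj : f.next^[b] y = j) (hij : h i = h j) : i = j := by
  wlog hab : a ≤ b generalizing i j a b
  · exact (this hj hi hij.symm (le_of_not_ge hab)).symm
  obtain ⟨c, rfl⟩ := Nat.exists_eq_add_of_le' hab
  rw [Function.iterate_add_apply, hi] at hj
  have h1 := height_iterate hh h0 c i
  rw [hj] at h1
  -- This makes `h j` positive, so the subtraction in `h1` is not truncated.
  have h2 := hh j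
  obtain rfl : c = 0 := by omega
  exact Subtype.ext hj

/-- A reduced walk in the support climbs towards `x₀` and then descends to `y`: climbing just after
descending would backtrack. A first step down lands on an ancestor of `y` (or `y` itself); a first
step up starts outside the ancestors of `y`, since otherwise the walk would later backtrack or miss
`y`. -/
theorem reducedWord_alternative {h : V → ℕ} (h0 : h x₀ = 0)
    (hh : ∀ i : {x : V // x ≠ x₀}, h i = h (f.next i) + 1) {x y : V} {e : E} {l : List E}
    (hw : X.IsWalk x (e :: l) y) (hs : ∀ a ∈ e :: l, a ∈ f.support)
    (hr : X.IsReducedWord (e :: l)) :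
    (∃ i k, e = X.inv (f i) ∧ f.next^[k] y = i) ∨
      (∃ i, e = f i ∧ ∀ k, f.next^[k] y ≠ i) := by
  induction l generalizing x e with
  | nil =>
    obtain ⟨rfl, hw⟩ := hw
    obtain rfl : X.tgt e = y := hw
    obtain ⟨i, rfl | rfl⟩ := hs e (by simp)
    · refine Or.inr ⟨i, rfl, fun k hk => ?_⟩
      rw [← next_coe] at hk
      have h1 := height_iterate hh h0 k (f.next i)
      have h2 := hh i
      rw [hk] at h1
      omega
    · exact Or.inl ⟨i, 0, rfl, by rw [X.tgt_inv]; exact (f i).2⟩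
  | cons e' l ih =>
    obtain ⟨rfl, hw⟩ := hw
    have hw1 := hw.1
    obtain ⟨hr1, hr2⟩ := List.isChain_cons_cons.1 hr
    obtain ⟨i, rfl | rfl⟩ := hs e (by simp)
    · refine Or.inr ⟨i, rfl, fun k hk => ?_⟩
      rw [← next_coe] at hw1
      obtain ⟨j, m, rfl, hm⟩ | ⟨j, rfl, hj⟩ := ih hw (fun a ha => hs a (by simp [ha])) hr2
      · rw [X.src_inv, ← next_coe] at hw1
        have : i = j := ancestor_unique h0 hh hk hm (by rw [hh, hh j, hw1])
        exact hr1 (by rw [this])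
      · apply hj (k + 1)
        rw [Function.iterate_succ_apply', hk, ← hw1, (f j).2]
    · rw [X.tgt_inv, (f i).2] at hw1
      obtain ⟨j, m, rfl, hm⟩ | ⟨j, rfl, hj⟩ := ih hw (fun a ha => hs a (by simp [ha])) hr2
      · rw [X.src_inv, ← next_coe] at hw1
        exact Or.inl ⟨i, m + 1, rfl, by rw [Function.iterate_succ_apply', hm, hw1]⟩
      · rw [(f j).2] at hw1
        obtain rfl := Subtype.ext hw1
        exact absurd (X.inv_inv _).symm hr1

/-- For a nonempty reduced loop both cases of `reducedWord_alternative` are absurd: a first step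
down would make a child an ancestor of its parent, and a first step up starts at the end point
itself. -/
theorem Flows.isTree [Nonempty V] (hf : f.Flows) :
    (X.edgeSubgraph f.support fun _ => f.inv_mem_support).IsTree := by
  refine isTree_edgeSubgraph_iff.2 ⟨fun x y => ?_, fun x l hl hs hr => ?_⟩
  · obtain ⟨l, hl, hls⟩ := hf.exists_isWalk x
    obtain ⟨m, hm, hms⟩ := hf.exists_isWalk y
    refine ⟨_, hl.append hm.reverse, fun e he => ?_⟩
    rw [List.mem_append, List.mem_reverse, List.mem_map] at he
    obtain he | ⟨e, he, rfl⟩ := he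
    · exact hls e he
    · exact f.inv_mem_support (hms e he)
  · obtain ⟨h, h0, hh⟩ := hf.exists_height
    match l, hl, hs, hr with
    | [], _, _, _ => rfl
    | e :: l, hl, hs, hr =>
      exfalso
      have hx := hl.1
      obtain ⟨i, k, rfl, hk⟩ | ⟨i, rfl, hi⟩ := reducedWord_alternative h0 hh hl hs hr
      · rw [X.src_inv, ← next_coe] at hx
        subst hx
        have h1 := height_iterate hh h0 k (f.next i)
        rw [hk] at h1
        have := hh i
        omega
      · exact hi 0 (hx.symm.trans (f i).2)

/-- Induction on the height of `i`. If `f i` were some `(g j)⁻¹`, then `j` is the lower vertex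
`f.next i`, where `f` and `g` already agree, so `f` would lead from `j` back up to `i`. -/
theorem Flows.eq_of_support_eq {g : X.OutChoice x₀} (hf : f.Flows)
    (hfg : f.support = g.support) : f = g := by
  obtain ⟨h, h0, hh⟩ := hf.exists_height
  funext i
  induction hn : h i using Nat.strong_induction_on generalizing i with
  | _ n ih =>
    have hi := hh i
    obtain ⟨j, hj⟩ : (f i : E) ∈ g.support := hfg ▸ ⟨i, Or.inl rfl⟩
    obtain hj | hj := hj
    · have h1 := (f i).2
      rw [hj, (g j).2] at h1
      obtain rfl := Subtype.ext h1
      exact Subtype.ext hj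
    · have hji : f.next i = j := by rw [next_coe, hj, X.tgt_inv, (g j).2]
      rw [hji] at hi
      have h2 := ih _ (by omega) j rfl
      have h3 : f.next j = i := by
        rw [next_coe, h2, ← X.src_inv, ← hj, (f i).2]
      have h4 := hh j
      rw [h3] at h4
      omega

theorem exists_flows_of_isTree {S : Set E} {hS : ∀ e ∈ S, X.inv e ∈ S}
    (hT : (X.edgeSubgraph S hS).IsTree) (x₀ : V) :
    ∃ f : X.OutChoice x₀, f.Flows ∧ f.support = S := by
  classical
  have := hT.1.1
  obtain ⟨hc, ha⟩ := isTree_edgeSubgraph_iff.1 hT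
  have hd : ∀ x, ∃ n, ∃ l : List E, X.IsWalk x l x₀ ∧ (∀ e ∈ l, e ∈ S) ∧ l.length = n := fun x => by
    obtain ⟨l, hl, hs⟩ := hc x x₀
    exact ⟨_, l, hl, hs, rfl⟩
  -- The chosen edge is the first one of a shortest walk to `x₀` inside the tree.
  have hf : ∀ i : {x : V // x ≠ x₀}, ∃ e : {e : E // X.src e = i}, (e : E) ∈ S ∧
      Nat.find (hd (X.tgt e)) < Nat.find (hd i) := fun i => by
    obtain ⟨l, hl, hs, hlen⟩ := Nat.find_spec (hd i)
    match l, hl with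
    | [], hl => exact absurd hl i.2
    | e :: l, hl =>
      refine ⟨⟨e, hl.1⟩, hs e (by simp), ?_⟩
      rw [← hlen, List.length_cons]
      exact Nat.lt_succ_of_le (Nat.find_min' _ ⟨l, hl.2, fun a ha => hs a (by simp [ha]), rfl⟩)
  choose f hfS hf using hf
  have hflow : OutChoice.Flows f := flows_of_lt (fun x => Nat.find (hd x)) hf
  have hsub : OutChoice.support f ⊆ S := by
    rintro e ⟨i, rfl | rfl⟩
    · exact hfS i
    · exact hS _ (hfS i)
  refine ⟨f, hflow, hsub.antisymm fun e he => by_contra fun hne => ?_⟩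
  -- An edge of the tree outside the support would close up, along a reduced walk in the support, to
  -- a nontrivial reduced loop; no cancellation occurs because the support is closed under inversion
  -- and misses `e`.
  obtain ⟨l, hl, hs⟩ := (isTree_edgeSubgraph_iff.1 hflow.isTree).1 (X.tgt e) (X.src e)
  obtain ⟨m, hm, hr, hml⟩ := hl.exists_reduced
  refine List.cons_ne_nil e m (ha (X.src e) (e :: m) ⟨rfl, hm⟩ ?_ ?_)
  · rintro a (_ | ⟨_, h⟩)
    · exact he
    · exact hsub (hs a (hml h))
  · refine List.isChain_cons.2 ⟨fun a h => ?_, hr⟩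
    rintro rfl
    have := OutChoice.inv_mem_support f (hs _ (hml (List.mem_of_mem_head? h)))
    rw [X.inv_inv] at this
    exact hne this

end OutChoice

/-- Spanning trees correspond to the choices of edges that lead to the base point. -/
theorem card_spanningTrees (X : SymmGraph V E) (x₀ : V) :
    Nat.card X.spanningTrees = Nat.card {f : X.OutChoice x₀ // f.Flows} := by
  have : Nonempty V := ⟨x₀⟩
  refine (Nat.card_eq_of_bijective
    (fun f : {f : X.OutChoice x₀ // f.Flows} =>
      (⟨f.1.support, fun _ => f.1.inv_mem_support, f.2.isTree⟩ : X.spanningTrees)) ⟨?_, ?_⟩).symm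
  · rintro ⟨f, hf⟩ ⟨g, _⟩ h
    exact Subtype.ext (hf.eq_of_support_eq (congrArg Subtype.val h))
  · rintro ⟨S, hS, hT⟩
    obtain ⟨f, hf, rfl⟩ := OutChoice.exists_flows_of_isTree hT x₀
    exact ⟨⟨f, hf⟩, rfl⟩

end SymmGraph

namespace SymmGraph

variable {V : Type u} {E : Type v} {X : SymmGraph V E}

/-! ### The reduced Laplacian and the matrix-tree theorem -/

namespace OutChoice

variable {x₀ : V} (f : X.OutChoice x₀)

/-- The matrix of the map `next`, restricted to the vertices other than `x₀`. -/
noncomputable def nextMatrix [DecidableEq V] : Matrix {x : V // x ≠ x₀} {x : V // x ≠ x₀} ℤ :=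
  fun i j => if f.next i = j then 1 else 0

variable {f}

/-- Orbits that reach `x₀` stay there and leave the index set, hence give zero entries. -/
theorem nextMatrix_pow [Fintype V] [DecidableEq V] (n : ℕ)
    (i j : {x : V // x ≠ x₀}) :
    (f.nextMatrix ^ n) i j = if f.next^[n] i = j then 1 else 0 := by
  induction n generalizing i with
  | zero =>
    rw [pow_zero, Matrix.one_apply]
    exact if_congr Subtype.ext_iff rfl rfl
  | succ n ih =>
    simp only [pow_succ', Matrix.mul_apply, ih, nextMatrix, ite_mul, one_mul, zero_mul]
    rw [Function.iterate_succ_apply]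
    by_cases h : f.next i = x₀
    · have h1 : f.next^[n] x₀ = x₀ := Function.iterate_fixed f.next_base n
      rw [h, h1, if_neg j.2.symm]
      exact Finset.sum_eq_zero fun k _ => if_neg k.2.symm
    · rw [Finset.sum_eq_single ⟨f.next i, h⟩]
      · simp
      · intro k _ hk
        exact if_neg fun h => hk (Subtype.ext h.symm)
      · simp

theorem Flows.det_one_sub [Fintype V] [DecidableEq V] (hf : f.Flows) :
    (1 - f.nextMatrix).det = 1 := by
  choose n hn using hf
  have hnil : IsNilpotent f.nextMatrix := by
    -- The sum of the arrival times serves as a common bound for them.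
    refine ⟨∑ x, n x, Matrix.ext fun i j => ?_⟩
    obtain ⟨k, hk⟩ := Nat.exists_eq_add_of_le' (Finset.single_le_sum (f := n)
      (fun _ _ => Nat.zero_le _) (Finset.mem_univ (i : V)))
    rw [nextMatrix_pow, hk, Function.iterate_add_apply, hn, Function.iterate_fixed f.next_base,
      if_neg j.2.symm, Matrix.zero_apply]
  -- As `ℤ[X]` is reduced, the characteristic polynomial is a power of `X`; its value at 1 is the
  -- determinant.
  have h := (Matrix.isNilpotent_charpoly_sub_pow_of_isNilpotent hnil).eq_zero
  rw [sub_eq_zero] at h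
  have := Matrix.eval_charpoly f.nextMatrix 1
  rw [h] at this
  simpa using this.symm

theorem det_one_sub_of_not_flows [Fintype V] [DecidableEq V] (hf : ¬ f.Flows) :
    (1 - f.nextMatrix).det = 0 := by
  rw [Flows, not_forall] at hf
  obtain ⟨x, hx⟩ := hf
  rw [not_exists] at hx
  classical
  -- The indicator of the vertices that never reach `x₀` is fixed by the matrix.
  refine Matrix.exists_mulVec_eq_zero_iff.1
    ⟨fun i => if ∃ n, f.next^[n] i = x₀ then 0 else 1, fun h => ?_, ?_⟩
  · have := congrFun h ⟨x, hx 0⟩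
    simp [hx] at this
  · ext i
    have key : (∃ n, f.next^[n] (f.next i) = x₀) ↔ ∃ n, f.next^[n] i = x₀ := by
      constructor
      · rintro ⟨n, hn⟩; exact ⟨n + 1, hn⟩
      · rintro ⟨_ | n, hn⟩
        · exact absurd hn i.2
        · exact ⟨n, hn⟩
    rw [Matrix.sub_mulVec, Matrix.one_mulVec, Pi.sub_apply, Pi.zero_apply, sub_eq_zero]
    simp only [Matrix.mulVec, dotProduct, nextMatrix, ite_mul, one_mul, zero_mul]
    by_cases h : f.next i = x₀
    · rw [if_pos (key.1 ⟨0, h⟩), eq_comm]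
      exact Finset.sum_eq_zero fun k _ => if_neg fun hk => k.2 (hk.symm.trans h)
    · rw [Finset.sum_eq_single ⟨f.next i, h⟩]
      · simp only [key, if_true]
      · intro k _ hk
        exact if_neg fun h => hk (Subtype.ext h.symm)
      · simp

end OutChoice

variable [Fintype V] [Fintype E] (X)

/-- The Laplacian of `X`, with the row and the column of `x₀` removed. -/
noncomputable def reducedLaplacian [DecidableEq V] (x₀ : V) : Matrix {x : V // x ≠ x₀} {x : V // x ≠ x₀} ℤ :=
  fun i j => ∑ e : {e : E // X.src e = i},
    ((if i = j then 1 else 0) - if X.tgt e = j then 1 else 0)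

/-- The matrix-tree theorem. -/
theorem det_reducedLaplacian [DecidableEq V] (x₀ : V) :
    (X.reducedLaplacian x₀).det = Nat.card X.spanningTrees := by
  classical
  have h1 : (X.reducedLaplacian x₀).det =
      ∑ f : X.OutChoice x₀, (1 - OutChoice.nextMatrix f).det := by
    -- Row `i` is the sum, over edges `e` leaving `i`, of `δ_i - δ_{t e}` with the coordinate `x₀`
    -- dropped; multilinearity turns the determinant into a sum over choices of edges.
    have := (Matrix.detRowAlternating (n := {x : V // x ≠ x₀}) (R := ℤ)).toMultilinearMap.map_sum
      (α := fun i => {e : E // X.src e = i})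
      (fun i e j => (if i = j then 1 else 0) - if X.tgt e = j then 1 else 0)
    calc _ = _ := ?_
      _ = _ := this
      _ = _ := ?_
    · change Matrix.det _ = Matrix.det _
      congr 1
      ext i j
      simp only [reducedLaplacian, Finset.sum_apply]
    · refine Finset.sum_congr rfl fun f _ => ?_
      change Matrix.det _ = Matrix.det _
      congr 1
      ext i j
      rw [Matrix.sub_apply, Matrix.one_apply, OutChoice.nextMatrix, OutChoice.next_coe]
  rw [h1, X.card_spanningTrees x₀, Nat.card_eq_fintype_card, Fintype.card_subtype,
    Finset.card_filter, Nat.cast_sum]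
  refine Finset.sum_congr rfl fun f _ => ?_
  split_ifs with hf
  · rw [OutChoice.Flows.det_one_sub hf, Nat.cast_one]
  · rw [OutChoice.det_one_sub_of_not_flows hf, Nat.cast_zero]

end SymmGraph

/-! ### The index of the image of an integer matrix -/

theorem Matrix.card_quotient_range_mulVec {n : Type*} [Fintype n] [DecidableEq n]
    (M : Matrix n n ℤ) (hM : M.det ≠ 0) :
    Nat.card ((n → ℤ) ⧸ LinearMap.range M.mulVecLin) = M.det.natAbs := by
  have hinj : Function.Injective M.mulVecLin := Matrix.mulVec_injective_of_det_ne_zero hM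
  have := Submodule.natAbs_det_equiv (LinearMap.range M.mulVecLin)
    (LinearEquiv.ofInjective M.mulVecLin hinj)
  rw [← this, ← LinearMap.det_toLin', Matrix.toLin'_apply']
  rfl

namespace SymmGraph

variable {V : Type u} {E : Type v} (X : SymmGraph V E)

/-! ### Coefficients and boundaries of chains -/

section

variable (R : Type w) [CommRing R]

theorem span_edges : Submodule.span R (Set.range (X.edge R)) = ⊤ := by
  refine Submodule.eq_top_iff'.2 fun c => ?_
  obtain ⟨a, rfl⟩ := X.chainMk_surjective R c
  induction a using Finsupp.induction_linear with
  | zero => rw [map_zero]; exact zero_mem _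
  | add a b ha hb => rw [map_add]; exact add_mem ha hb
  | single e r =>
    have h : X.chainMk R (Finsupp.single e r) = r • X.edge R e := by
      rw [edge, ← map_smul]; simp
    rw [h]
    exact Submodule.smul_mem _ _ (Submodule.subset_span ⟨e, rfl⟩)

theorem chains_hom_ext {M : Type z} [AddCommGroup M] [Module R M] {f g : X.Chains₁ R →ₗ[R] M}
    (h : ∀ e, f (X.edge R e) = g (X.edge R e)) : f = g :=
  LinearMap.ext_on_range (X.span_edges R) h

theorem boundary_edge (e : E) : X.boundary R (X.edge R e) =
    Finsupp.single (X.tgt e) 1 - Finsupp.single (X.src e) 1 :=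
  X.lift_edge R _ _ e

theorem coeff_edge [DecidableEq E] (e : E) : X.coeff R (X.edge R e) =
    Pi.single e 1 - Pi.single (X.inv e) 1 := by
  rw [coeff, lift_edge]
  congr!

theorem inv_involutive : Function.Involutive X.inv := X.inv_inv

theorem coeff_inv (c : X.Chains₁ R) (e : E) : X.coeff R c (X.inv e) = - X.coeff R c e := by
  classical
  have : LinearMap.proj (X.inv e) ∘ₗ X.coeff R = -(LinearMap.proj e ∘ₗ X.coeff R) := by
    refine X.chains_hom_ext R fun a => ?_
    simp [coeff_edge, Pi.single_apply, X.inv_involutive.eq_iff, X.inv_inv]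
  exact LinearMap.congr_fun this c

/-- Of `e` and `e⁻¹`, take the smaller in a well-order; they are distinct by `inv_ne`. -/
theorem exists_orientation : ∃ O : Set E, ∀ e, X.inv e ∈ O ↔ e ∉ O := by
  refine ⟨{e | WellOrderingRel e (X.inv e)}, fun e => ?_⟩
  simp only [Set.mem_ofPred_eq, X.inv_inv]
  refine ⟨fun h k => asymm h k, fun h => ?_⟩
  exact ((trichotomous_of WellOrderingRel e (X.inv e)).resolve_left h).resolve_left
    (X.inv_ne e).symm

theorem sum_boundary [Fintype V] (c : X.Chains₁ R) : ∑ v, X.boundary R c v = 0 := by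
  classical
  have : (∑ v : V, Finsupp.lapply v ∘ₗ X.boundary R) = 0 := by
    refine X.chains_hom_ext R fun a => ?_
    simp [boundary_edge, Finsupp.single_apply, LinearMap.sum_apply]
  have h := LinearMap.congr_fun this c
  rw [LinearMap.sum_apply] at h
  exact h

variable [Fintype E]

theorem sum_inv {M : Type z} [AddCommMonoid M] (φ : E → M) : ∑ e, φ (X.inv e) = ∑ e, φ e :=
  Equiv.sum_comp X.inv_involutive.toPerm φ

/-- Summing over all edges recovers only `2 • c`; summing over an orientation recovers `c` over any
ring. -/
theorem coeff_injective : Function.Injective (X.coeff R) := by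
  classical
  obtain ⟨O, hO⟩ := X.exists_orientation
  have : (∑ a : E, if a ∈ O then (LinearMap.proj a ∘ₗ X.coeff R).smulRight (X.edge R a) else 0) =
      LinearMap.id := by
    refine X.chains_hom_ext R fun e => ?_
    rw [LinearMap.sum_apply, LinearMap.id_apply]
    have h : ∀ a, (if a ∈ O then (LinearMap.proj a ∘ₗ X.coeff R).smulRight (X.edge R a) else 0)
        (X.edge R e) = (if a = e then if a ∈ O then X.edge R a else 0 else 0) -
          if a = X.inv e then if a ∈ O then X.edge R a else 0 else 0 := fun a => by
      by_cases ha : a ∈ O <;> simp [ha, coeff_edge, Pi.single_apply, sub_smul]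
    simp only [h, Finset.sum_sub_distrib, Finset.sum_ite_eq', Finset.mem_univ, if_true, hO,
      edge_inv]
    by_cases he : e ∈ O <;> simp [he]
  refine Function.HasLeftInverse.injective
    ⟨fun φ => ∑ a : E, if a ∈ O then φ a • X.edge R a else 0, fun c => ?_⟩
  have h := LinearMap.congr_fun this c
  rw [LinearMap.sum_apply, LinearMap.id_apply] at h
  refine Eq.trans (Finset.sum_congr rfl fun a _ => ?_) h
  split_ifs <;> rfl

theorem exists_coeff_eq (φ : E → R) (hφ : ∀ e, φ (X.inv e) = - φ e) :
    ∃ c, X.coeff R c = φ := by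
  classical
  obtain ⟨O, hO⟩ := X.exists_orientation
  refine ⟨∑ a : E, if a ∈ O then φ a • X.edge R a else 0, funext fun e => ?_⟩
  have h : ∀ a, X.coeff R (if a ∈ O then φ a • X.edge R a else 0) e =
      (if a = e then if a ∈ O then φ a else 0 else 0) -
          if a = X.inv e then if a ∈ O then φ a else 0 else 0 := fun a => by
    have h1 : e = a ↔ a = e := eq_comm
    have h2 : e = X.inv a ↔ a = X.inv e := by rw [← X.inv_involutive.eq_iff, eq_comm]
    by_cases ha : a ∈ O <;> simp [ha, coeff_edge, Pi.single_apply, mul_sub, h1, h2]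
  simp only [map_sum, Finset.sum_apply, h, Finset.sum_sub_distrib, Finset.sum_ite_eq',
    Finset.mem_univ, if_true, hO, hφ]
  by_cases he : e ∈ O <;> simp [he]

/-- Only targets appear because the sum runs over both orientations: `e⁻¹` accounts for the source
of `e`. -/
theorem boundary_apply [DecidableEq V] (c : X.Chains₁ R) (v : V) :
    X.boundary R c v = ∑ e, if X.tgt e = v then X.coeff R c e else 0 := by
  classical
  have : Finsupp.lapply v ∘ₗ X.boundary R =
      ∑ e : E, if X.tgt e = v then LinearMap.proj e ∘ₗ X.coeff R else 0 := by
    refine X.chains_hom_ext R fun a => ?_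
    have h : ∀ e, (if X.tgt e = v then LinearMap.proj e ∘ₗ X.coeff R else 0) (X.edge R a) =
        (if e = a then if X.tgt e = v then 1 else 0 else 0) -
          if e = X.inv a then if X.tgt e = v then 1 else 0 else 0 := fun e => by
      by_cases he : X.tgt e = v <;> simp [he, coeff_edge, Pi.single_apply]
    simp only [LinearMap.sum_apply, h, Finset.sum_sub_distrib, Finset.sum_ite_eq',
      Finset.mem_univ, if_true, X.tgt_inv]
    simp [boundary_edge, Finsupp.single_apply]
  have h := LinearMap.congr_fun this c
  rw [LinearMap.sum_apply] at h
  refine h.trans (Finset.sum_congr rfl fun e _ => ?_)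
  split_ifs <;> rfl

/-- Chains of the form `∂* g` are orthogonal to cycles. -/
theorem sum_coboundary_mul_coeff [Fintype V] (g : V → R) {z : X.Chains₁ R}
    (hz : z ∈ X.cycles R) :
    ∑ e, (g (X.tgt e) - g (X.src e)) * X.coeff R z e = 0 := by
  classical
  have h1 : ∑ e, g (X.tgt e) * X.coeff R z e = 0 := by
    calc _ = ∑ e, ∑ v, if X.tgt e = v then g v * X.coeff R z e else 0 := by simp
      _ = ∑ v, g v * X.boundary R z v := by
        rw [Finset.sum_comm]
        simp only [boundary_apply, Finset.mul_sum, mul_ite, mul_zero]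
      _ = 0 := by
        rw [show X.boundary R z = 0 from hz]
        simp
  have h2 : ∑ e, g (X.src e) * X.coeff R z e = -∑ e, g (X.tgt e) * X.coeff R z e := by
    rw [← X.sum_inv fun e => g (X.tgt e) * X.coeff R z e]
    simp [X.tgt_inv, coeff_inv]
  simp only [sub_mul, Finset.sum_sub_distrib, h2, h1, neg_zero, sub_zero]

theorem sum_coeff_mul_coeff_edge (c : X.Chains₁ R) (a : E) :
    ∑ e, X.coeff R c e * X.coeff R (X.edge R a) e = 2 * X.coeff R c a := by
  classical
  simp [coeff_edge, mul_sub, Pi.single_apply, Finset.sum_sub_distrib, coeff_inv, two_mul]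

end

/-! ### Chains of words -/

/-- The 1-chain of a word. -/
noncomputable def wordChain (l : List E) : X.Chains₁ ℤ := (l.map (X.edge ℤ)).sum

@[simp] theorem wordChain_nil : X.wordChain [] = 0 := rfl

@[simp] theorem wordChain_cons (e : E) (l : List E) :
    X.wordChain (e :: l) = X.edge ℤ e + X.wordChain l := by simp [wordChain]

@[simp] theorem wordChain_append (l m : List E) :
    X.wordChain (l ++ m) = X.wordChain l + X.wordChain m := by simp [wordChain]

@[simp] theorem wordChain_reverse_inv (l : List E) :
    X.wordChain (l.map X.inv).reverse = - X.wordChain l := by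
  induction l with
  | nil => simp
  | cons e l ih => simp [ih, edge_inv, add_comm]

variable {X}

theorem IsWalk.boundary_wordChain {x y : V} {l : List E} (h : X.IsWalk x l y) :
    X.boundary ℤ (X.wordChain l) = Finsupp.single y 1 - Finsupp.single x 1 := by
  induction l generalizing x with
  | nil => obtain rfl : x = y := h; simp
  | cons e l ih =>
    obtain ⟨rfl, h⟩ := h
    rw [wordChain_cons, map_add, ih h, boundary_edge]
    abel

theorem Connected.exists_isWalk (hX : X.Connected) (x y : V) : ∃ l, X.IsWalk x l y :=
  nonempty_path_iff.1 (hX.2 x y)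

/-- Every integral cycle is the chain of a loop at a given vertex. -/
theorem Connected.exists_loop (hX : X.Connected) (x₀ : V) {c : X.Chains₁ ℤ}
    (hc : c ∈ X.cycles ℤ) : ∃ l, X.IsWalk x₀ l x₀ ∧ X.wordChain l = c := by
  choose w hw using hX.exists_isWalk x₀
  let H : AddSubgroup (X.Chains₁ ℤ) :=
    { carrier := {c | ∃ l, X.IsWalk x₀ l x₀ ∧ X.wordChain l = c}
      zero_mem' := ⟨[], rfl, rfl⟩
      add_mem' := by
        rintro _ _ ⟨l, hl, rfl⟩ ⟨m, hm, rfl⟩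
        exact ⟨l ++ m, hl.append hm, by simp⟩
      neg_mem' := by
        rintro _ ⟨l, hl, rfl⟩
        exact ⟨_, hl.reverse, by simp⟩ }
  let Φ := Finsupp.linearCombination ℤ fun v => X.wordChain (w v)
  -- For an edge this difference is the chain of the loop that runs to `s(e)`, along `e`, and back
  -- from `t(e)`; on cycles the correction term vanishes.
  have key : ∀ a, a - Φ (X.boundary ℤ a) ∈ H := fun a => by
    have ha : a ∈ Submodule.span ℤ (Set.range (X.edge ℤ)) := X.span_edges ℤ ▸ Submodule.mem_top
    induction ha using Submodule.span_induction with
    | zero => simp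
    | add a b _ _ ha hb =>
      convert H.add_mem ha hb using 1
      rw [map_add, map_add]; abel
    | smul n a _ ha =>
      convert H.zsmul_mem ha n using 1
      rw [map_smul, map_smul, smul_sub]
    | mem a ha =>
      obtain ⟨e, rfl⟩ := ha
      refine ⟨w (X.src e) ++ ([e] ++ ((w (X.tgt e)).map X.inv).reverse),
        (hw _).append ((isWalk_singleton e).append (hw _).reverse), ?_⟩
      simp [Φ, boundary_edge]
      abel
  have := key c
  rw [show X.boundary ℤ c = 0 from hc, map_zero, sub_zero] at this
  exact this

/-- An integral chain that is orthogonal to all integral cycles is of the form `∂* g`. -/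
theorem Connected.exists_potential [Fintype E] (hX : X.Connected) (x₀ : V) {c : X.Chains₁ ℤ}
    (hc : ∀ a ∈ X.cycles ℤ, ∑ e, X.coeff ℤ c e * X.coeff ℤ a e = 0) :
    ∃ g : V → ℤ, g x₀ = 0 ∧ ∀ e, X.coeff ℤ c e = g (X.tgt e) - g (X.src e) := by
  choose w hw using hX.exists_isWalk x₀
  let P : X.Chains₁ ℤ → ℤ := fun a => ∑ e, X.coeff ℤ c e * X.coeff ℤ a e
  have P_add : ∀ a b, P (a + b) = P a + P b := fun a b => by
    simp [P, mul_add, Finset.sum_add_distrib]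
  have P_edge : ∀ e, P (X.edge ℤ e) = 2 * X.coeff ℤ c e := X.sum_coeff_mul_coeff_edge ℤ c
  have P_word : ∀ l, P (X.wordChain l) = 2 * (l.map (X.coeff ℤ c)).sum := fun l => by
    induction l with
    | nil => simp [P]
    | cons e l ih => rw [wordChain_cons, P_add, ih, P_edge, List.map_cons, List.sum_cons, mul_add]
  -- The potential sums `c` along the chosen walks. Pairing with the loop `w x₀`, which need not be
  -- empty, gives `g x₀ = 0`; pairing with the loop through `e` gives the difference along `e`.
  refine ⟨fun v => ((w v).map (X.coeff ℤ c)).sum, ?_, fun e => ?_⟩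
  · have h : P (X.wordChain (w x₀)) = 0 := hc _ (by
      rw [cycles, LinearMap.mem_ker, (hw x₀).boundary_wordChain, sub_self])
    rw [P_word] at h
    exact (mul_eq_zero.1 h).resolve_left two_ne_zero
  · have h : P (X.wordChain (w (X.src e)) + X.edge ℤ e + - X.wordChain (w (X.tgt e))) = 0 :=
      hc _ (by
        rw [cycles, LinearMap.mem_ker, map_add, map_add, map_neg, (hw _).boundary_wordChain,
          (hw _).boundary_wordChain, boundary_edge]
        abel)
    have h2 : P (-X.wordChain (w (X.tgt e))) = - P (X.wordChain (w (X.tgt e))) := by simp [P]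
    rw [P_add, P_add, h2, P_word, P_word, P_edge] at h
    dsimp only
    omega

end SymmGraph

namespace SymmGraph

variable {V : Type u} {E : Type v} {X : SymmGraph V E}

/-! ### Integral chains as real chains -/

theorem toReal_edge (e : E) : X.toReal (X.edge ℤ e) = X.edge ℝ e := X.lift_edge ℤ _ (X.edge_inv ℝ) e

theorem coeff_toReal (c : X.Chains₁ ℤ) (e : E) :
    X.coeff ℝ (X.toReal c) e = (X.coeff ℤ c e : ℝ) := by
  classical
  have : ((LinearMap.proj e ∘ₗ X.coeff ℝ).toAddMonoidHom.comp X.toReal).toIntLinearMap =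
      (Int.castAddHom ℝ).toIntLinearMap ∘ₗ LinearMap.proj e ∘ₗ X.coeff ℤ := by
    refine X.chains_hom_ext ℤ fun a => ?_
    change X.coeff ℝ (X.toReal (X.edge ℤ a)) e = ((X.coeff ℤ (X.edge ℤ a) e : ℤ) : ℝ)
    rw [toReal_edge, coeff_edge, coeff_edge, Pi.sub_apply, Pi.sub_apply, Int.cast_sub]
    simp only [Pi.single_apply, Int.cast_ite, Int.cast_one, Int.cast_zero]
  exact LinearMap.congr_fun this c

/-- The coordinates of a boundary sum to zero, so the one at `x₀` follows from the others. -/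
theorem mem_cycles_of_boundary_eq_zero [Fintype V] {R : Type w} [CommRing R] {c : X.Chains₁ R}
    (x₀ : V) (h : ∀ i, i ≠ x₀ → X.boundary R c i = 0) : c ∈ X.cycles R := by
  refine LinearMap.mem_ker.2 (Finsupp.ext fun v => ?_)
  by_cases hv : v = x₀
  · rw [hv]
    exact (Finset.sum_eq_single x₀ (fun i _ hi => h i hi) (by simp)).symm.trans (X.sum_boundary R c)
  · exact h v hv

theorem IsWalk.exists_crossing {x y : V} {l : List E} (h : X.IsWalk x l y) (p : V → Prop)
    (hx : ¬ p x) (hy : p y) : ∃ e ∈ l, ¬ p (X.src e) ∧ p (X.tgt e) := by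
  induction l generalizing x with
  | nil => obtain rfl : x = y := h; exact absurd hy hx
  | cons e l ih =>
    obtain ⟨rfl, h⟩ := h
    by_cases ht : p (X.tgt e)
    · exact ⟨e, by simp, hx, ht⟩
    · obtain ⟨f, hf, hp⟩ := ih h ht
      exact ⟨f, by simp [hf], hp⟩

theorem exists_isWalk_of_not_isBridge {e : E} (he : ¬ X.IsBridge e) :
    ∃ l, X.IsWalk (X.src e) l (X.tgt e) ∧ e ∉ l := by
  simp only [IsBridge, not_exists, not_and, not_isEmpty_iff] at he
  obtain ⟨l, hl, h⟩ := exists_isWalk_edgeSubgraph_iff.1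
    (nonempty_path_iff.1 (he _ _ (nonempty_path_iff.2 ⟨_, isWalk_singleton e⟩)))
  exact ⟨l, hl, fun hel => (h e hel).1 rfl⟩

section

variable [Fintype E]

theorem inner_toReal (c : X.Chains₁ ℤ) (d : X.Chains₁ ℝ) : inner ℝ (X.toReal c) d =
    (1 / 2) * ∑ e, (X.coeff ℤ c e : ℝ) * X.coeff ℝ d e := by
  simp only [inner_def, coeff_toReal]

theorem toReal_mem_cycles {c : X.Chains₁ ℤ} (hc : c ∈ X.cycles ℤ) :
    X.toReal c ∈ X.cycles ℝ := by
  classical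
  refine LinearMap.mem_ker.2 (Finsupp.ext fun v => ?_)
  have h : X.boundary ℤ c v = 0 := by rw [show X.boundary ℤ c = 0 from hc]; rfl
  rw [boundary_apply] at h ⊢
  have := congrArg (Int.cast (R := ℝ)) h
  push_cast at this
  simpa only [coeff_toReal, Finsupp.coe_zero, Pi.zero_apply] using this

theorem proj_toReal_of_mem_cycles {c : X.Chains₁ ℤ} (hc : c ∈ X.cycles ℤ) :
    X.proj (X.toReal c) = ⟨X.toReal c, toReal_mem_cycles hc⟩ :=
  Submodule.orthogonalProjectionOnto_mem_subspace_eq_self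
    (⟨X.toReal c, toReal_mem_cycles hc⟩ : X.cycles ℝ)

theorem mem_integralCycles_iff {z : X.cycles ℝ} :
    z ∈ X.integralCycles ↔ ∃ c ∈ X.cycles ℤ, X.proj (X.toReal c) = z := by
  constructor
  · rintro ⟨c, hc, h⟩
    exact ⟨c, hc, (proj_toReal_of_mem_cycles hc).trans (Subtype.ext h)⟩
  · rintro ⟨c, hc, rfl⟩
    rw [proj_toReal_of_mem_cycles hc]
    exact ⟨c, hc, rfl⟩

variable [Fintype V]

/-- The integral chains that project to zero are the integral cuts. -/
theorem Connected.proj_toReal_eq_zero_iff (hX : X.Connected) (x₀ : V) {c : X.Chains₁ ℤ} :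
    X.proj (X.toReal c) = 0 ↔
      ∃ g : V → ℤ, g x₀ = 0 ∧ ∀ e, X.coeff ℤ c e = g (X.tgt e) - g (X.src e) := by
  rw [proj, Submodule.orthogonalProjectionOnto_eq_zero_iff, Submodule.mem_orthogonal']
  constructor
  · intro h
    refine hX.exists_potential x₀ fun a ha => ?_
    have := h _ (toReal_mem_cycles ha)
    rw [inner_toReal] at this
    simp only [coeff_toReal] at this
    have h2 := (mul_eq_zero.1 this).resolve_left (by norm_num)
    exact_mod_cast h2
  · rintro ⟨g, -, hg⟩ z hz
    rw [inner_toReal]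
    have := X.sum_coboundary_mul_coeff ℝ (fun v => (g v : ℝ)) hz
    simp only [hg, Int.cast_sub, this, mul_zero]

/-- In a graph without bridges there is no integral cut with boundary `x - y` unless `x = y`. -/
theorem eq_of_boundary_eq (hbridge : ∀ e : E, ¬ X.IsBridge e) {c : X.Chains₁ ℤ} {g : V → ℤ}
    (hg : ∀ e, X.coeff ℤ c e = g (X.tgt e) - g (X.src e)) {x y : V}
    (hc : X.boundary ℤ c = Finsupp.single x 1 - Finsupp.single y 1) : x = y := by
  classical
  by_contra hxy
  -- If `g` never increases along an edge, it never decreases either, so `c = 0`, against `x ≠ y`.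
  obtain ⟨e, he⟩ : ∃ e, g (X.src e) < g (X.tgt e) := by
    by_contra! hle
    have h0 : X.coeff ℤ c = 0 := funext fun e => by
      have h1 := hle e
      have h2 := hle (X.inv e)
      rw [X.src_inv, X.tgt_inv] at h2
      rw [hg, Pi.zero_apply]
      omega
    rw [X.coeff_injective ℤ (h0.trans (map_zero _).symm), map_zero] at hc
    have := DFunLike.congr_fun hc x
    rw [Finsupp.coe_sub, Pi.sub_apply, Finsupp.single_eq_same,
      Finsupp.single_eq_of_ne hxy] at this
    simp at this
  obtain ⟨l, hl, hel⟩ := exists_isWalk_of_not_isBridge (hbridge e)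
  -- The superlevel set `U` is entered by `e` and, since `e` is not a bridge, by a second edge `f`.
  -- Every entering edge has coefficient at least 1, so the flow into `U` is at least 2; but it
  -- equals the sum of `x - y` over `U`, which is at most 1.
  set U : V → Prop := fun v => g (X.tgt e) ≤ g v with hU
  obtain ⟨f, hfl, hf⟩ := hl.exists_crossing U (not_le.2 he) le_rfl
  have hfe : e ≠ f := fun h => hel (h ▸ hfl)
  have h1 : ∑ v, (if U v then X.boundary ℤ c v else 0) ≤ 1 := by
    have : ∀ v, (if U v then X.boundary ℤ c v else 0) =
        (if x = v then if U v then 1 else 0 else 0) -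
          if y = v then if U v then 1 else 0 else 0 := fun v => by
      rw [hc, Finsupp.coe_sub, Pi.sub_apply, Finsupp.single_apply, Finsupp.single_apply]
      split_ifs <;> rfl
    simp only [this, Finset.sum_sub_distrib, Finset.sum_ite_eq, Finset.mem_univ, if_true]
    split_ifs <;> norm_num
  have h2 : ∑ v, (if U v then X.boundary ℤ c v else 0) =
      ∑ a, if U (X.tgt a) then X.coeff ℤ c a else 0 := by
    calc _ = ∑ v, ∑ a, if X.tgt a = v then if U v then X.coeff ℤ c a else 0 else 0 := by
          refine Finset.sum_congr rfl fun v _ => ?_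
          rw [boundary_apply]
          split_ifs <;> simp
      _ = _ := by
          rw [Finset.sum_comm]
          simp
  -- Edges inside `U` cancel against their inverses.
  have h3 : ∑ a, (if U (X.tgt a) ∧ U (X.src a) then X.coeff ℤ c a else 0) = 0 := by
    have := X.sum_inv fun a => if U (X.tgt a) ∧ U (X.src a) then X.coeff ℤ c a else 0
    have h4 : ∀ a, (if U (X.tgt (X.inv a)) ∧ U (X.src (X.inv a)) then X.coeff ℤ c (X.inv a) else 0) =
        -(if U (X.tgt a) ∧ U (X.src a) then X.coeff ℤ c a else 0) := fun a => by
      simp only [X.tgt_inv, X.src_inv, coeff_inv, and_comm (a := U (X.src a))]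
      split_ifs <;> simp
    simp only [h4, Finset.sum_neg_distrib] at this
    omega
  have h5 : ∀ a, (if U (X.tgt a) ∧ U (X.src a) then X.coeff ℤ c a else 0) +
      ((if e = a then 1 else 0) + if f = a then 1 else 0) ≤
      if U (X.tgt a) then X.coeff ℤ c a else 0 := fun a => by
    have hUe : U (X.tgt e) ∧ ¬ U (X.src e) := ⟨le_rfl, not_le.2 he⟩
    by_cases hea : e = a
    · subst hea
      rw [if_neg fun h => hUe.2 h.2, if_pos rfl, if_neg hfe.symm, if_pos hUe.1, hg]
      omega
    by_cases hfa : f = a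
    · subst hfa
      rw [if_neg fun h => hf.1 h.2, if_neg hea, if_pos rfl, if_pos hf.2, hg]
      have h6 := hf.1
      have h7 := hf.2
      simp only [hU] at h6 h7
      omega
    rw [if_neg hea, if_neg hfa]
    by_cases ht : U (X.tgt a)
    · by_cases hs : U (X.src a)
      · rw [if_pos ⟨ht, hs⟩, if_pos ht]; simp
      · rw [if_neg fun h => hs h.2, if_pos ht, hg]
        simp only [hU] at ht hs
        omega
    · rw [if_neg fun h => ht h.1, if_neg ht]; simp
  have h8 := Finset.sum_le_sum fun a (_ : a ∈ Finset.univ) => h5 a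
  rw [Finset.sum_add_distrib, Finset.sum_add_distrib, h3, Finset.sum_ite_eq, Finset.sum_ite_eq,
    if_pos (Finset.mem_univ _), if_pos (Finset.mem_univ _), ← h2] at h8
  omega

/-! ### The quotient of the lattice `L` -/

/-- This is `∂∂* = Δ`; the condition `g x₀ = 0` allows the column of `x₀` to be deleted. -/
theorem boundary_eq_reducedLaplacian [DecidableEq V] {x₀ : V} {c : X.Chains₁ ℤ} {g : V → ℤ}
    (h0 : g x₀ = 0) (hg : ∀ e, X.coeff ℤ c e = g (X.tgt e) - g (X.src e))
    (i : {x : V // x ≠ x₀}) :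
    X.boundary ℤ c i = (X.reducedLaplacian x₀).mulVec (fun j => g j) i := by
  have hsum : ∀ v : V, (∑ j : {x : V // x ≠ x₀}, if v = (j : V) then g j else 0) = g v := fun v => by
    by_cases hv : v = x₀
    · rw [hv, h0]
      exact Finset.sum_eq_zero fun j _ => if_neg j.2.symm
    · rw [Finset.sum_eq_single ⟨v, hv⟩]
      · simp
      · exact fun j _ hj => if_neg fun h => hj (Subtype.ext h.symm)
      · simp
  have h1 : X.boundary ℤ c i = ∑ e : {e : E // X.src e = i}, (g i - g (X.tgt e)) := by
    -- Inverting the edges turns the sum over edges into `i` into one over edges out of `i`.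
    rw [boundary_apply, ← X.sum_inv]
    simp only [X.tgt_inv, hg, X.src_inv]
    rw [← Finset.sum_filter, Finset.sum_subtype (p := fun e => X.src e = i) _ (by simp)]
    exact Finset.sum_congr rfl fun e _ => by rw [e.2]
  rw [h1]
  simp only [Matrix.mulVec, dotProduct, reducedLaplacian, Finset.sum_mul]
  rw [Finset.sum_comm]
  refine Finset.sum_congr rfl fun e _ => ?_
  simp only [sub_mul, ite_mul, one_mul, zero_mul, Finset.sum_sub_distrib, hsum]
  simp

omit [Fintype V] in
theorem exists_cut (x₀ : V) (g : {x : V // x ≠ x₀} → ℤ) :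
    ∃ (g' : V → ℤ) (c : X.Chains₁ ℤ), g' x₀ = 0 ∧ (fun i : {x : V // x ≠ x₀} => g' i) = g ∧
      ∀ e, X.coeff ℤ c e = g' (X.tgt e) - g' (X.src e) := by
  classical
  let g' : V → ℤ := fun v => if h : v = x₀ then 0 else g ⟨v, h⟩
  obtain ⟨c, hc⟩ := X.exists_coeff_eq ℤ (fun e => g' (X.tgt e) - g' (X.src e))
    (fun e => by rw [X.tgt_inv, X.src_inv, neg_sub])
  exact ⟨g', c, by simp [g'], funext fun i => by simp [g', i.2], fun e => congrFun hc e⟩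

/-- A kernel vector gives a cut that is also a cycle, hence orthogonal to itself and zero; its
potential is then constant along walks from `x₀`, where it is 0. -/
theorem Connected.det_reducedLaplacian_ne_zero [DecidableEq V] (hX : X.Connected) (x₀ : V) :
    (X.reducedLaplacian x₀).det ≠ 0 := by
  intro hdet
  obtain ⟨g, hg0, hg⟩ := Matrix.exists_mulVec_eq_zero_iff.2 hdet
  obtain ⟨g', c, h0, rfl, hc⟩ := exists_cut (X := X) x₀ g
  have hcyc : c ∈ X.cycles ℤ := mem_cycles_of_boundary_eq_zero x₀ fun i hi => by
    rw [boundary_eq_reducedLaplacian h0 hc ⟨i, hi⟩, hg, Pi.zero_apply]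
  have h := X.sum_coboundary_mul_coeff ℤ g' hcyc
  simp only [← hc] at h
  rw [Finset.sum_eq_zero_iff_of_nonneg fun e _ => mul_self_nonneg _] at h
  apply hg0
  funext ⟨v, hv⟩
  by_contra hne
  obtain ⟨l, hl⟩ := hX.exists_isWalk x₀ v
  obtain ⟨e, -, hs, ht⟩ := hl.exists_crossing (fun v => g' v ≠ 0) (not_not.2 h0) hne
  have h1 := hc e
  rw [mul_self_eq_zero.1 (h e (Finset.mem_univ _)), not_not.1 hs, sub_zero] at h1
  exact ht h1.symm

theorem Connected.proj_toReal_mem_integralCycles_iff [DecidableEq V] (hX : X.Connected) (x₀ : V)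
    {c : X.Chains₁ ℤ} : X.proj (X.toReal c) ∈ X.integralCycles ↔
      (fun i : {x : V // x ≠ x₀} => X.boundary ℤ c i) ∈
        LinearMap.range (X.reducedLaplacian x₀).mulVecLin := by
  rw [mem_integralCycles_iff]
  constructor
  · rintro ⟨a, ha, h⟩
    obtain ⟨g, h0, hg⟩ := (hX.proj_toReal_eq_zero_iff x₀ (c := c - a)).1 (by
      rw [map_sub, map_sub, h, sub_self])
    refine ⟨fun i => g i, funext fun i => ?_⟩
    rw [Matrix.mulVecLin_apply, ← boundary_eq_reducedLaplacian h0 hg, map_sub,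
      show X.boundary ℤ a = 0 from ha, sub_zero]
  · rintro ⟨g, h⟩
    obtain ⟨g', d, h0, rfl, hd⟩ := exists_cut (X := X) x₀ g
    refine ⟨c - d, mem_cycles_of_boundary_eq_zero x₀ fun i hi => ?_, ?_⟩
    · have := congrFun h ⟨i, hi⟩
      rw [Matrix.mulVecLin_apply, ← boundary_eq_reducedLaplacian h0 hd] at this
      rw [map_sub, Finsupp.coe_sub, Pi.sub_apply, sub_eq_zero]
      exact this.symm
    · rw [map_sub, map_sub, (hX.proj_toReal_eq_zero_iff x₀).2 ⟨g', h0, hd⟩, sub_zero]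

/-- The integral chains map onto both `L / Z₁(X, ℤ)` and the cokernel of the reduced Laplacian, with
the same kernel. -/
theorem Connected.card_latticeQuotient (hX : X.Connected) :
    Nat.card X.LatticeQuotient = Nat.card X.spanningTrees ∧ Nat.card X.LatticeQuotient ≠ 0 := by
  classical
  obtain ⟨x₀⟩ := hX.1
  let M := X.reducedLaplacian x₀
  let φ : X.Chains₁ ℤ →+ X.LatticeQuotient := (QuotientAddGroup.mk' _).comp
    (((X.proj : X.Chains₁ ℝ →ₗ[ℝ] X.cycles ℝ).toAddMonoidHom.comp X.toReal).rangeRestrict)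
  let r : X.Chains₁ ℤ →ₗ[ℤ] ({x : V // x ≠ x₀} → ℤ) :=
    LinearMap.pi fun i => Finsupp.lapply (i : V) ∘ₗ X.boundary ℤ
  let ψ : X.Chains₁ ℤ →+ ({x : V // x ≠ x₀} → ℤ) ⧸ LinearMap.range M.mulVecLin :=
    ((LinearMap.range M.mulVecLin).mkQ ∘ₗ r).toAddMonoidHom
  have hφ : Function.Surjective φ :=
    (QuotientAddGroup.mk'_surjective _).comp (AddMonoidHom.rangeRestrict_surjective _)
  have hψ : Function.Surjective ψ := by
    refine (Submodule.mkQ_surjective _).comp fun b => ?_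
    choose w hw using hX.exists_isWalk x₀
    -- A walk from `x₀` to `i` has the `i`-th basis vector as its boundary away from `x₀`.
    refine ⟨∑ i, b i • X.wordChain (w i), funext fun j => ?_⟩
    have : ∀ i : {x : V // x ≠ x₀}, X.boundary ℤ (X.wordChain (w i)) j = if i = j then 1 else 0 :=
      fun i => by
        rw [(hw i).boundary_wordChain, Finsupp.coe_sub, Pi.sub_apply, Finsupp.single_apply,
          Finsupp.single_eq_of_ne j.2, sub_zero]
        exact if_congr Subtype.ext_iff.symm rfl rfl
    rw [map_sum, Finset.sum_apply]
    refine Eq.trans (Finset.sum_congr rfl fun i _ => ?_)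
      ((Finset.sum_ite_eq' _ j b).trans (by simp))
    rw [map_smul, Pi.smul_apply]
    change b i • X.boundary ℤ (X.wordChain (w i)) j = _
    rw [this, smul_ite, smul_zero, smul_eq_mul, mul_one]
  have hker : φ.ker = ψ.ker := by
    ext c
    have h1 : φ c = 0 ↔ X.proj (X.toReal c) ∈ X.integralCycles :=
      (QuotientAddGroup.eq_zero_iff _).trans AddSubgroup.mem_addSubgroupOf
    have h2 : ψ c = 0 ↔ r c ∈ LinearMap.range M.mulVecLin := Submodule.Quotient.mk_eq_zero _
    rw [AddMonoidHom.mem_ker, AddMonoidHom.mem_ker, h1, h2]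
    exact hX.proj_toReal_mem_integralCycles_iff x₀
  have hcard : Nat.card X.LatticeQuotient = M.det.natAbs := by
    rw [← Matrix.card_quotient_range_mulVec M (hX.det_reducedLaplacian_ne_zero x₀)]
    exact Nat.card_congr
      ((QuotientAddGroup.quotientKerEquivOfSurjective φ hφ).symm.trans
        ((QuotientAddGroup.quotientAddEquivOfEq hker).trans
          (QuotientAddGroup.quotientKerEquivOfSurjective ψ hψ))).toEquiv
  rw [hcard]
  refine ⟨?_, Int.natAbs_ne_zero.2 (hX.det_reducedLaplacian_ne_zero x₀)⟩
  rw [X.det_reducedLaplacian x₀, Int.natAbs_natCast]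

/-! ### The quotient of the set of atoms -/

omit [Fintype V] in
theorem mem_atoms_iff {x₀ : V} {a : X.cycles ℝ} :
    a ∈ X.atoms x₀ ↔ ∃ x l, X.IsWalk x₀ l x ∧ a = X.proj (X.toReal (X.wordChain l)) := by
  constructor
  · rintro ⟨x, p, rfl⟩
    exact ⟨x, p.edges, p.isWalk, rfl⟩
  · rintro ⟨x, l, hl, rfl⟩
    obtain ⟨p, rfl⟩ := hl.exists_path
    exact ⟨x, p, rfl⟩

omit [Fintype V] in
-- The cycle is realised as a loop at `x₀` and run before the path.
theorem Connected.add_mem_atoms (hX : X.Connected) (x₀ : V) {c a : X.cycles ℝ}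
    (hc : c ∈ X.integralCycles) (ha : a ∈ X.atoms x₀) : c + a ∈ X.atoms x₀ := by
  obtain ⟨d, hd, rfl⟩ := mem_integralCycles_iff.1 hc
  obtain ⟨l, hl, rfl⟩ := hX.exists_loop x₀ hd
  obtain ⟨x, m, hm, rfl⟩ := mem_atoms_iff.1 ha
  exact mem_atoms_iff.2 ⟨x, l ++ m, hl.append hm, by simp⟩

/-- A vertex is sent to the class of a chosen walk to it. Equality of two classes yields an integral
cut with boundary `x - y`, which `eq_of_boundary_eq` excludes for `x ≠ y`. -/
theorem Connected.card_atomQuotient (hX : X.Connected) (hbridge : ∀ e : E, ¬ X.IsBridge e)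
    (x₀ : V) : Nat.card (X.AtomQuotient x₀) = Nat.card V := by
  choose w hw using hX.exists_isWalk x₀
  refine (Nat.card_eq_of_bijective (fun v => (Quotient.mk (X.atomSetoid x₀)
    ⟨X.proj (X.toReal (X.wordChain (w v))), mem_atoms_iff.2 ⟨v, w v, hw v, rfl⟩⟩ :
      X.AtomQuotient x₀)) ⟨fun x y hxy => ?_, ?_⟩).symm
  · obtain ⟨z, hz, h⟩ := Quotient.exact hxy
    obtain ⟨c, hc, rfl⟩ := mem_integralCycles_iff.1 hz
    obtain ⟨g, -, hg⟩ := (hX.proj_toReal_eq_zero_iff x₀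
      (c := c + X.wordChain (w x) - X.wordChain (w y))).1 (by
        rw [map_sub, map_sub, map_add, map_add, sub_eq_zero]; exact h)
    refine eq_of_boundary_eq hbridge hg ?_
    rw [map_sub, map_add, show X.boundary ℤ c = 0 from hc, (hw x).boundary_wordChain,
      (hw y).boundary_wordChain]
    abel
  · rintro ⟨a, ha⟩
    obtain ⟨x, l, hl, rfl⟩ := mem_atoms_iff.1 ha
    refine ⟨x, Quotient.sound ⟨X.proj (X.toReal (X.wordChain l - X.wordChain (w x))),
      mem_integralCycles_iff.2 ⟨_, ?_, rfl⟩, ?_⟩⟩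
    · rw [cycles, LinearMap.mem_ker, map_sub, hl.boundary_wordChain, (hw x).boundary_wordChain,
        sub_self]
    · rw [map_sub, map_sub]
      exact sub_add_cancel _ _

end

end SymmGraph

/-! ### The packing fraction -/

theorem mainTheorem3 {V : Type u} {E : Type v} [Fintype V] [Fintype E] (X : SymmGraph V E)
    (hconn : X.Connected) (hbridge : ∀ e : E, ¬ X.IsBridge e) (x₀ : V) :
    -- `Z₁(X, ℤ)` lies in `A`, `A` lies in `L`, and `Z₁(X, ℤ)` acts on `A` by translations
    ((X.integralCycles : Set (X.cycles ℝ)) ⊆ X.atoms x₀ ∧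
      X.atoms x₀ ⊆ (X.latticeL : Set (X.cycles ℝ)) ∧
      ∀ c ∈ X.integralCycles, ∀ a ∈ X.atoms x₀, c + a ∈ X.atoms x₀) ∧
    -- both quotients are finite, and the packing fraction is `|V| / |T|`
    Finite (X.AtomQuotient x₀) ∧ Finite X.LatticeQuotient ∧
    X.packingFraction x₀ = (Nat.card V : ℚ) / (Nat.card X.spanningTrees : ℚ) ∧
    Nat.card (X.AtomQuotient x₀) = Nat.card V ∧
    Nat.card X.LatticeQuotient = Nat.card X.spanningTrees := by
  have hA := hconn.card_atomQuotient hbridge x₀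
  obtain ⟨hL, hL0⟩ := hconn.card_latticeQuotient
  have : Nonempty V := hconn.1
  -- `Nat.card` is 0 on infinite types, so the nonzero cardinalities give finiteness.
  refine ⟨⟨fun z hz => ?_, ?_, fun c hc a ha => hconn.add_mem_atoms x₀ hc ha⟩,
    Nat.finite_of_card_ne_zero (hA ▸ Nat.card_pos.ne'), Nat.finite_of_card_ne_zero hL0, ?_, hA, hL⟩
  · obtain ⟨c, hc, rfl⟩ := SymmGraph.mem_integralCycles_iff.1 hz
    obtain ⟨l, hl, rfl⟩ := hconn.exists_loop x₀ hc
    exact SymmGraph.mem_atoms_iff.2 ⟨x₀, l, hl, rfl⟩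
  · rintro _ ⟨x, α, rfl⟩
    exact ⟨α.chain, rfl⟩
  · rw [SymmGraph.packingFraction, hA, hL]
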